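/- **Stability.** Let $\mathbb S^k\subset\mathbb R^{k+1}$ be the unit sphere with the induced metric, $d(x,y)=\arccos(x\cdot y)$ its geodesic distance, $N=(0,\dots,0,1)$, $\varepsilon\in(0,\pi/2)$ and $$\mathcal D_\varepsilon=\{x\in\mathbb S^k : d(x,N)<\tfrac{\pi}{2}-\varepsilon\}.$$ Let $K(x,y)=g(d(x,y)^2)$, where $g:[0,\infty)\to\mathbb R$ is differentiable with locally Lipschitz continuous derivative. Denote by $\mathcal P(\mathcal D_\varepsilon)$ the set of Borel probability measures on $\mathcal D_\varepsilon$. For a curve $(\rho_t)_{t\in[0,T)}\subset\mathcal P(\mathcal D_\varepsilon)$, $T\in(0,\infty]$, let $$v[\rho](x,t)=-\int_{\mathcal D_\varepsilon}\nabla_{\mathbb S^k}K(\cdot,y)(x)\,\mathrm d\rho_t(y).$$ The curve is a *weak solution* on $[0,T)$ of the aggregation equation $\partial_t\rho-\nabla_{\mathbb S^k}\cdot(\rho\,\nabla_{\mathbb S^k}K*\rho)=0$ on $\mathcal D_\varepsilon$, starting from $\rho_0$, if there is a unique map $\Psi:\operatorname{supp}(\rho_0)\times[0,T)\to\mathcal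 D_\varepsilon$ with $\Psi^0(x)=x$ and $\frac{\mathrm d}{\mathrm dt}\Psi^t(x)=v[\rho](\Psi^t(x),t)$ for all $x\in\operatorname{supp}(\rho_0)$ and $t\in[0,T)$ (supports are taken in $\mathcal D_\varepsilon$), and if $\rho_t=\Psi^t\#\rho_0$ for all $t\in[0,T)$. Let $$W_1(\mu,\nu)=\inf_{\pi}\int_{\mathcal D_\varepsilon\times\mathcal D_\varepsilon}d(x,y)\,\mathrm d\pi(x,y),$$ the infimum being over all probability measures $\pi$ on $\mathcal D_\varepsilon\times\mathcal D_\varepsilon$ with marginals $\mu$ and $\nu$. Put $f(\theta)=\theta/\sin\theta$ for $\theta\in(0,\pi)$, $f(0)=1$; let $C_f(\varepsilon)$ and $L_f(\varepsilon)$ be the suprema of $f$ and $f'$ on $[0,\pi-2\varepsilon]$, let $C_{g'}(\varepsilon)$ and $L_{g'}(\varepsilon)$ be the supremum of $|g'|$ and the Lipschitz constant of $g'$ on $[0,(\pi-2\varepsilon)^2]$, and set $$L(\varepsilon)=4\pi^2L_{g'}(\varepsilon)+4C_{g'}(\varepsilon)\bigl(C_f(\varepsilon)+L_f(\varepsilon)\bigr),\qquad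 r(\varepsilon,t)=e^{(2L(\varepsilon)+4\pi C_{g'}(\varepsilon))t}.$$ Let $\rho_0,\sigma_0\in\mathcal P(\mathcal D_\varepsilon)$, and let $\rho$ and $\sigma$ be weak solutions on $[0,T)$ starting from $\rho_0$ and $\sigma_0$, respectively. Then there exists $T^*\in(0,T)$ such that $$W_1(\rho_t,\sigma_t)\le r(\varepsilon,t)\,W_1(\rho_0,\sigma_0)\qquad\text{for all }t\in[0,T^*);$$ moreover, $r(\varepsilon,0)=1$, and $r(\varepsilon,\cdot)$ is nondecreasing and bounded on $[0,T^*)$. -/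

import Mathlib

open Set MeasureTheory

noncomputable section

namespace SphereAggregation

/-- The ambient Euclidean space `ℝ^{k+1}`, containing the unit sphere `S^k = {x : ‖x‖ = 1}`. -/
abbrev Ambient (k : ℕ) : Type := EuclideanSpace ℝ (Fin (k + 1))

/-- The north pole `N = (0, …, 0, 1)`. -/
def northPole (k : ℕ) : Ambient k := EuclideanSpace.single (Fin.last k) 1

/-- The geodesic distance `d(x, y) = arccos (x · y)` between points of the unit sphere. -/
def sphereDist {k : ℕ} (x y : Ambient k) : ℝ := Real.arccos (inner ℝ x y)

/-- The open geodesic disk `D_ε = {x ∈ S^k : d(x, N) < π/2 - ε}`. -/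
def disk (k : ℕ) (ε : ℝ) : Set (Ambient k) :=
  {x | x ∈ Metric.sphere (0 : Ambient k) 1 ∧ sphereDist x (northPole k) < Real.pi / 2 - ε}

/-- The Riemannian gradient at a point `x` of the unit sphere (with the metric induced by the
ambient space, tangent vectors being seen as ambient vectors) of a function `F` on the sphere.
It is the Euclidean gradient at `x` of the extension `z ↦ F (z / ‖z‖)` of `F` which is constant
in the radial direction; only the values of `F` on the unit sphere matter. -/
def sphereGradient {k : ℕ} (F : Ambient k → ℝ) (x : Ambient k) : Ambient k :=
  gradient (fun z => F (‖z‖⁻¹ • z)) x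

/-- The derivative `g'` of a function `g` on `[0, ∞)` (one-sided at `0`). -/
def profileDeriv (g : ℝ → ℝ) : ℝ → ℝ := derivWithin g (Ici 0)

/-- The assumption on the profile `g : [0, ∞) → ℝ`: it is differentiable, and its derivative is
locally Lipschitz continuous. Values of `g` at negative numbers play no role. -/
structure IsAdmissibleProfile (g : ℝ → ℝ) : Prop where
  differentiableOn : DifferentiableOn ℝ g (Ici 0)
  locallyLipschitzOn_deriv : LocallyLipschitzOn (Ici 0) (profileDeriv g)

/-- The interaction potential `K(x, y) = g(d(x, y)²)`. -/
def potential {k : ℕ} (g : ℝ → ℝ) (x y : Ambient k) : ℝ := g (sphereDist x y ^ 2)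

/-- The velocity field `v[μ](x) = -(∇K * μ)(x) = -∫ ∇_x K(x, y) dμ(y)` of a probability
measure `μ` on `D_ε`. -/
def velocity {k : ℕ} {ε : ℝ} (g : ℝ → ℝ) (μ : ProbabilityMeasure (disk k ε))
    (x : disk k ε) : Ambient k :=
  -∫ y : disk k ε, sphereGradient (fun z => potential g z (y : Ambient k)) (x : Ambient k)
    ∂(μ : Measure (disk k ε))

/-- The time interval `[0, T)`, where `T` may be `∞`. -/
def timeInterval (T : EReal) : Set ℝ := {t | 0 ≤ t ∧ (t : EReal) < T}

/-- `Ψ` is a flow map defined on `A × [0, T)`, with values in `D_ε`, generated by the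
time-dependent vector field `X`. Values of `Ψ` off `A × [0, T)` play no role. -/
structure IsFlowMap {k : ℕ} {ε : ℝ} (X : disk k ε → ℝ → Ambient k) (A : Set (disk k ε))
    (T : EReal) (Ψ : disk k ε → ℝ → disk k ε) : Prop where
  initial : ∀ x ∈ A, Ψ x 0 = x
  hasDeriv : ∀ x ∈ A, ∀ t ∈ timeInterval T,
    HasDerivWithinAt (fun s => (Ψ x s : Ambient k)) (X (Ψ x t) t) (timeInterval T) t

/-- `(ρ_t)`, `t ∈ [0, T)`, is a weak solution of the aggregation equation on `D_ε`: the velocity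
field `v[ρ]` generates a unique flow map `Ψ` on `supp ρ₀ × [0, T)`, and `ρ_t` is the push-forward
of `ρ₀` under `Ψ(·, t)` for all `t ∈ [0, T)`. Since `ρ_t` is a probability measure, the last
equation contains the almost everywhere measurability of `Ψ(·, t)`. -/
def IsWeakSolution {k : ℕ} {ε : ℝ} (g : ℝ → ℝ) (T : EReal)
    (ρ : ℝ → ProbabilityMeasure (disk k ε)) : Prop :=
  ∃ Ψ : disk k ε → ℝ → disk k ε,
    IsFlowMap (fun x t => velocity g (ρ t) x) (ρ 0 : Measure (disk k ε)).support T Ψ ∧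
    (∀ Φ : disk k ε → ℝ → disk k ε,
      IsFlowMap (fun x t => velocity g (ρ t) x) (ρ 0 : Measure (disk k ε)).support T Φ →
      ∀ x ∈ (ρ 0 : Measure (disk k ε)).support, ∀ t ∈ timeInterval T, Φ x t = Ψ x t) ∧
    ∀ t ∈ timeInterval T,
      (ρ t : Measure (disk k ε)) = (ρ 0 : Measure (disk k ε)).map (fun x => Ψ x t)

/-- The transport plans between two probability measures on `D_ε`. -/
def transportPlans {k : ℕ} {ε : ℝ} (μ ν : ProbabilityMeasure (disk k ε)) :
    Set (ProbabilityMeasure (disk k ε × disk k ε)) :=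
  {π | (π : Measure (disk k ε × disk k ε)).map Prod.fst = (μ : Measure (disk k ε)) ∧
    (π : Measure (disk k ε × disk k ε)).map Prod.snd = (ν : Measure (disk k ε))}

/-- The intrinsic `1`-Wasserstein distance. -/
def wasserstein {k : ℕ} {ε : ℝ} (μ ν : ProbabilityMeasure (disk k ε)) : ℝ :=
  sInf ((fun π : ProbabilityMeasure (disk k ε × disk k ε) =>
    ∫ p, sphereDist (p.1 : Ambient k) (p.2 : Ambient k)
      ∂(π : Measure (disk k ε × disk k ε))) '' transportPlans μ ν)

/-- The function `f(θ) = θ / sin θ`, with `f(0) = 1`. -/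
def angleRatio (θ : ℝ) : ℝ := if θ = 0 then 1 else θ / Real.sin θ

/-- `C_f(ε)`, the supremum of `f` on `[0, π - 2ε]`. -/
def ratioSup (ε : ℝ) : ℝ := sSup (angleRatio '' Icc 0 (Real.pi - 2 * ε))

/-- `L_f(ε)`, the supremum of `f'` on `[0, π - 2ε]`. -/
def ratioDerivSup (ε : ℝ) : ℝ := sSup (deriv angleRatio '' Icc 0 (Real.pi - 2 * ε))

/-- `C_{g'}(ε)`, the supremum of `|g'|` on `[0, (π - 2ε)²]`. -/
def profileDerivSup (g : ℝ → ℝ) (ε : ℝ) : ℝ :=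
  sSup ((fun s => |profileDeriv g s|) '' Icc 0 ((Real.pi - 2 * ε) ^ 2))

/-- `L_{g'}(ε)`, the (smallest) Lipschitz constant of `g'` on `[0, (π - 2ε)²]`. -/
def profileDerivLip (g : ℝ → ℝ) (ε : ℝ) : ℝ :=
  sInf {L | 0 ≤ L ∧ ∀ s ∈ Icc 0 ((Real.pi - 2 * ε) ^ 2), ∀ t ∈ Icc 0 ((Real.pi - 2 * ε) ^ 2),
    |profileDeriv g s - profileDeriv g t| ≤ L * |s - t|}

/-- The constant `4π² L_{g'}(ε) + 4 C_{g'}(ε) (C_f(ε) + L_f(ε))`. -/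
def lipConst (g : ℝ → ℝ) (ε : ℝ) : ℝ :=
  4 * Real.pi ^ 2 * profileDerivLip g ε +
    4 * profileDerivSup g ε * (ratioSup ε + ratioDerivSup ε)

/-- The stability factor `r(ε, t) = exp ((2 L(ε) + 4π C_{g'}(ε)) t)`, where `L(ε)` is
`lipConst g ε`. -/
def stabilityFactor (g : ℝ → ℝ) (ε t : ℝ) : ℝ :=
  Real.exp ((2 * lipConst g ε + 4 * Real.pi * profileDerivSup g ε) * t)

end SphereAggregation

end

open SphereAggregation

namespace SphereAggregation

/-! ### The function `θ / sin θ` -/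

/-! On the disk, `-∇ₓK(x, z)` equals `2 g'(d²) log_x z`, with `log_x z = f(d) · (z - (x·z) x)` and
`d = d(x, z) ≤ π - 2ε < π`; this is `pairForce` (`sphereGradient_potential`). If `X`, `Y` move with
velocities `V`, `W`, their distance `θ > 0` satisfies `θ' = -(V·Y + W·X) / sin θ`, so stability
rests on showing that the numerator carries a factor `sin θ`.

Two cancellations supply it. For a common source `z`, the sum `F(x,z)·y + F(y,z)·x` is at most `L θ
sin θ`, by a half-angle identity (`abs_inner_logMap_add_le`). Replacing `z` by `w` in the second
force changes it by a vector tangent at `y`, whose product with `x` is at most `L d(z,w) sin θ`.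
Here `L` is `forceLip`.

Let `π` be a plan between the initial measures, transported by the two flows. It is also a coupling
of the sources of the two velocity fields, so each pair obeys `θ' ≤ L θ + L E`, where `E` is the
`π`-mean of `θ`. Grönwall gives `E(t) ≤ e^{2Lt} E(0)`; the transported plan couples `ρ_t` and `σ_t`,
and the infimum over `π` gives the contraction estimate. It holds on all of `[0, T)`, and `2L` is at
most the exponent in `r`. -/

theorem angleRatio_eq_inv_sinc (θ : ℝ) : angleRatio θ = (Real.sinc θ)⁻¹ := by
  unfold angleRatio Real.sinc
  split_ifs <;> simp

theorem angleRatio_neg (θ : ℝ) : angleRatio (-θ) = angleRatio θ := by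
  simp [angleRatio_eq_inv_sinc]

theorem angleRatio_mul_sin {θ : ℝ} (h0 : 0 ≤ θ) (hπ : θ < Real.pi) :
    angleRatio θ * Real.sin θ = θ := by
  rcases h0.eq_or_lt with rfl | h
  · simp
  · rw [angleRatio, if_neg h.ne', div_mul_cancel₀ _ (Real.sin_pos_of_pos_of_lt_pi h hπ).ne']

theorem angleRatio_nonneg {θ : ℝ} (h0 : 0 ≤ θ) (hπ : θ ≤ Real.pi) : 0 ≤ angleRatio θ := by
  unfold angleRatio
  split_ifs
  · exact zero_le_one
  · exact div_nonneg h0 (Real.sin_nonneg_of_nonneg_of_le_pi h0 hπ)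

theorem continuousOn_angleRatio : ContinuousOn angleRatio (Ico 0 Real.pi) := by
  have h : angleRatio = fun θ => (Real.sinc θ)⁻¹ := funext angleRatio_eq_inv_sinc
  rw [h]
  refine Real.continuous_sinc.continuousOn.inv₀ fun θ hθ => ?_
  rcases hθ.1.eq_or_lt with rfl | h
  · simp
  · rw [Real.sinc_of_ne_zero h.ne']
    exact div_ne_zero (Real.sin_pos_of_pos_of_lt_pi h hθ.2).ne' h.ne'

theorem hasDerivAt_angleRatio {θ : ℝ} (h0 : 0 < θ) (hπ : θ < Real.pi) :
    HasDerivAt angleRatio ((Real.sin θ - θ * Real.cos θ) / Real.sin θ ^ 2) θ := by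
  have h := (hasDerivAt_id θ).div (Real.hasDerivAt_sin θ) (Real.sin_pos_of_pos_of_lt_pi h0 hπ).ne'
  simp only [id, one_mul] at h
  refine h.congr_of_eventuallyEq ?_
  filter_upwards [eventually_ne_nhds h0.ne'] with x hx
  simp [angleRatio, hx]

/-- This is the sign of the numerator of `f'`: `f` is nondecreasing, so the supremum of `f'` without
absolute value already serves as a Lipschitz constant. -/
theorem mul_cos_le_sin {θ : ℝ} (h0 : 0 ≤ θ) (hπ : θ ≤ Real.pi) :
    θ * Real.cos θ ≤ Real.sin θ := by
  rcases lt_or_ge θ (Real.pi / 2) with h | h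
  · have hc : 0 < Real.cos θ := Real.cos_pos_of_mem_Ioo ⟨by linarith, h⟩
    have := Real.le_tan h0 h
    rwa [Real.tan_eq_sin_div_cos, le_div_iff₀ hc] at this
  · have hc : Real.cos θ ≤ 0 := Real.cos_nonpos_of_pi_div_two_le_of_le h (by linarith)
    have := Real.sin_nonneg_of_nonneg_of_le_pi h0 hπ
    nlinarith

/-- Evenness makes this value equal to its own negative; differentiability at `0` is not needed. -/
theorem deriv_angleRatio_zero : deriv angleRatio 0 = 0 := by
  have h : deriv (fun x => angleRatio (-x)) 0 = -deriv angleRatio (-0) :=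
    deriv_comp_neg angleRatio 0
  simp only [angleRatio_neg, neg_zero] at h
  have : deriv angleRatio 0 = -deriv angleRatio 0 := h
  linarith

section Constants

variable {ε : ℝ}

theorem bddAbove_angleRatio (hε : 0 < ε) :
    BddAbove (angleRatio '' Icc 0 (Real.pi - 2 * ε)) :=
  (isCompact_Icc.image_of_continuousOn (continuousOn_angleRatio.mono fun _ hx =>
    ⟨hx.1, by linarith [hx.2]⟩)).bddAbove

theorem angleRatio_le_ratioSup (hε : 0 < ε) {θ : ℝ} (hθ : θ ∈ Icc 0 (Real.pi - 2 * ε)) :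
    angleRatio θ ≤ ratioSup ε :=
  le_csSup (bddAbove_angleRatio hε) (mem_image_of_mem _ hθ)

theorem ratioSup_nonneg (hε : 0 < ε) (hε' : ε < Real.pi / 2) : 0 ≤ ratioSup ε :=
  (angleRatio_nonneg le_rfl Real.pi_pos.le).trans
    (angleRatio_le_ratioSup hε ⟨le_rfl, by linarith⟩)

theorem bddAbove_deriv_angleRatio (hε : 0 < ε) :
    BddAbove (deriv angleRatio '' Icc 0 (Real.pi - 2 * ε)) := by
  refine ⟨Real.pi / 2 * ratioSup ε ^ 2, ?_⟩
  rintro _ ⟨θ, hθ, rfl⟩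
  rcases hθ.1.eq_or_lt with rfl | h0
  · rw [deriv_angleRatio_zero]
    have := Real.pi_pos
    positivity
  · have hπ : θ < Real.pi := by linarith [hθ.2]
    have hs := Real.sin_pos_of_pos_of_lt_pi h0 hπ
    rw [(hasDerivAt_angleRatio h0 hπ).deriv]
    -- From `sin θ ≤ θ` and `cos θ ≥ 1 - θ²/2`; dividing by `sin² θ` yields `f' ≤ (θ/2) f²`, bounded
    -- near `0` as well.
    have h1 : Real.sin θ - θ * Real.cos θ ≤ θ / 2 * θ ^ 2 := by
      have := Real.sin_le h0.le
      nlinarith [Real.one_sub_sq_div_two_le_cos (x := θ)]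
    have h2 : (Real.sin θ - θ * Real.cos θ) / Real.sin θ ^ 2 ≤ θ / 2 * angleRatio θ ^ 2 := by
      rw [angleRatio, if_neg h0.ne', div_pow, ← mul_div_assoc]
      gcongr
    have h3 := angleRatio_nonneg h0.le hπ.le
    have h4 := angleRatio_le_ratioSup hε hθ
    have := Real.pi_pos
    calc _ ≤ θ / 2 * angleRatio θ ^ 2 := h2
      _ ≤ Real.pi / 2 * ratioSup ε ^ 2 := by gcongr

theorem deriv_angleRatio_le (hε : 0 < ε) {θ : ℝ}
    (hθ : θ ∈ Icc 0 (Real.pi - 2 * ε)) : deriv angleRatio θ ≤ ratioDerivSup ε :=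
  le_csSup (bddAbove_deriv_angleRatio hε) (mem_image_of_mem _ hθ)

theorem ratioDerivSup_nonneg (hε : 0 < ε) (hε' : ε < Real.pi / 2) : 0 ≤ ratioDerivSup ε :=
  deriv_angleRatio_zero.symm.le.trans (deriv_angleRatio_le hε ⟨le_rfl, by linarith⟩)

theorem abs_angleRatio_sub_le (hε : 0 < ε) {θ η : ℝ}
    (hθ : θ ∈ Icc 0 (Real.pi - 2 * ε)) (hη : η ∈ Icc 0 (Real.pi - 2 * ε)) :
    |angleRatio θ - angleRatio η| ≤ ratioDerivSup ε * |θ - η| := by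
  wlog h : η ≤ θ generalizing θ η
  · rw [abs_sub_comm, abs_sub_comm θ]
    exact this hη hθ (le_of_not_ge h)
  have hc : ContinuousOn angleRatio (Icc 0 (Real.pi - 2 * ε)) :=
    continuousOn_angleRatio.mono fun _ hx => ⟨hx.1, by linarith [hx.2]⟩
  have hI : ∀ x ∈ interior (Icc 0 (Real.pi - 2 * ε)), 0 < x ∧ x < Real.pi := by
    intro x hx
    rw [interior_Icc] at hx
    exact ⟨hx.1, by linarith [hx.2]⟩
  have hd : DifferentiableOn ℝ angleRatio (interior (Icc 0 (Real.pi - 2 * ε))) := fun x hx =>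
    (hasDerivAt_angleRatio (hI x hx).1 (hI x hx).2).differentiableAt.differentiableWithinAt
  have h1 := (convex_Icc (0 : ℝ) (Real.pi - 2 * ε)).image_sub_le_mul_sub_of_deriv_le hc hd
    (fun x hx => deriv_angleRatio_le hε (interior_subset hx)) η hη θ hθ h
  have h2 := (convex_Icc (0 : ℝ) (Real.pi - 2 * ε)).mul_sub_le_image_sub_of_le_deriv hc hd
    (C := 0) (fun x hx => by
      rw [(hasDerivAt_angleRatio (hI x hx).1 (hI x hx).2).deriv]
      exact div_nonneg (sub_nonneg.2 (mul_cos_le_sin (hI x hx).1.le (hI x hx).2.le))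
        (sq_nonneg _)) η hη θ hθ h
  rw [abs_of_nonneg (by linarith), abs_of_nonneg (sub_nonneg.2 h)]
  exact h1

/-! ### The derivative of the profile -/

variable {g : ℝ → ℝ}

theorem IsAdmissibleProfile.continuousOn_profileDeriv (hg : IsAdmissibleProfile g) :
    ContinuousOn (profileDeriv g) (Ici 0) :=
  hg.locallyLipschitzOn_deriv.continuousOn

theorem abs_profileDeriv_le (hg : IsAdmissibleProfile g) {s : ℝ}
    (hs : s ∈ Icc 0 ((Real.pi - 2 * ε) ^ 2)) : |profileDeriv g s| ≤ profileDerivSup g ε :=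
  le_csSup (isCompact_Icc.image_of_continuousOn
    (hg.continuousOn_profileDeriv.mono Icc_subset_Ici_self).abs).bddAbove
    (mem_image_of_mem (fun s => |profileDeriv g s|) hs)

theorem profileDerivSup_nonneg : 0 ≤ profileDerivSup g ε := by
  apply Real.sSup_nonneg
  rintro _ ⟨s, -, rfl⟩
  exact abs_nonneg _

theorem profileDerivLip_nonneg : 0 ≤ profileDerivLip g ε :=
  Real.sInf_nonneg fun _ h => h.1

/-- The infimum defining the constant is itself admissible: each difference quotient is a lower
bound of the set, which is nonempty because a locally Lipschitz function is Lipschitz on a compact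
set. -/
theorem abs_profileDeriv_sub_le (hg : IsAdmissibleProfile g) {s t : ℝ}
    (hs : s ∈ Icc 0 ((Real.pi - 2 * ε) ^ 2)) (ht : t ∈ Icc 0 ((Real.pi - 2 * ε) ^ 2)) :
    |profileDeriv g s - profileDeriv g t| ≤ profileDerivLip g ε * |s - t| := by
  rcases eq_or_ne s t with rfl | hst
  · simp
  have hpos : 0 < |s - t| := abs_pos.2 (sub_ne_zero.2 hst)
  rw [← div_le_iff₀ hpos]
  obtain ⟨K, hK⟩ := (hg.locallyLipschitzOn_deriv.mono
    (fun _ h => h.1 : Icc 0 ((Real.pi - 2 * ε) ^ 2) ⊆ Ici 0)).exists_lipschitzOnWith_of_compact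
    isCompact_Icc
  refine le_csInf ⟨K, K.2, fun s hs t ht => ?_⟩ fun L hL => ?_
  · simpa [Real.dist_eq] using hK.dist_le_mul s hs t ht
  · rw [div_le_iff₀ hpos]
    exact hL.2 s hs t ht

end Constants

/-! ### Geometry of unit vectors -/

section Geometry

variable {k : ℕ} {x y z w : Ambient k}

theorem sphereDist_eq_angle (hx : ‖x‖ = 1) (hy : ‖y‖ = 1) :
    sphereDist x y = InnerProductGeometry.angle x y := by
  simp [sphereDist, InnerProductGeometry.angle, hx, hy]

theorem sphereDist_comm (x y : Ambient k) : sphereDist x y = sphereDist y x := by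
  rw [sphereDist, sphereDist, real_inner_comm]

theorem sphereDist_nonneg (x y : Ambient k) : 0 ≤ sphereDist x y := Real.arccos_nonneg _

theorem sphereDist_le_pi (x y : Ambient k) : sphereDist x y ≤ Real.pi := Real.arccos_le_pi _

theorem sphereDist_triangle (hx : ‖x‖ = 1) (hy : ‖y‖ = 1) (hz : ‖z‖ = 1) :
    sphereDist x z ≤ sphereDist x y + sphereDist y z := by
  rw [sphereDist_eq_angle hx hy, sphereDist_eq_angle hy hz, sphereDist_eq_angle hx hz]
  exact InnerProductGeometry.angle_le_angle_add_angle x y z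

theorem abs_sphereDist_sub_le (hx : ‖x‖ = 1) (hy : ‖y‖ = 1) (hz : ‖z‖ = 1) :
    |sphereDist x z - sphereDist y z| ≤ sphereDist x y := by
  have h1 := sphereDist_triangle hx hy hz
  have h2 := sphereDist_triangle hy hx hz
  rw [sphereDist_comm y x] at h2
  rw [abs_le]
  constructor <;> linarith

theorem cos_sphereDist (hx : ‖x‖ = 1) (hy : ‖y‖ = 1) :
    Real.cos (sphereDist x y) = inner ℝ x y := by
  rw [sphereDist_eq_angle hx hy, InnerProductGeometry.cos_angle, hx, hy]
  simp

theorem sin_sphereDist_nonneg (x y : Ambient k) : 0 ≤ Real.sin (sphereDist x y) :=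
  Real.sin_nonneg_of_nonneg_of_le_pi (sphereDist_nonneg x y) (sphereDist_le_pi x y)

theorem sin_half_sphereDist_nonneg (x y : Ambient k) : 0 ≤ Real.sin (sphereDist x y / 2) :=
  Real.sin_nonneg_of_nonneg_of_le_pi (by linarith [sphereDist_nonneg x y])
    (by linarith [sphereDist_le_pi x y, Real.pi_pos])

theorem cos_half_sphereDist_nonneg (x y : Ambient k) : 0 ≤ Real.cos (sphereDist x y / 2) :=
  Real.cos_nonneg_of_mem_Icc ⟨by linarith [sphereDist_nonneg x y, Real.pi_pos],
    by linarith [sphereDist_le_pi x y]⟩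

theorem inner_eq_one_sub (hx : ‖x‖ = 1) (hy : ‖y‖ = 1) :
    inner ℝ x y = 1 - 2 * Real.sin (sphereDist x y / 2) ^ 2 := by
  rw [← cos_sphereDist hx hy]
  have h := Real.cos_two_mul (sphereDist x y / 2)
  rw [mul_div_cancel₀ _ two_ne_zero, Real.cos_sq'] at h
  linarith

theorem norm_sub_eq_two_mul_sin (hx : ‖x‖ = 1) (hy : ‖y‖ = 1) :
    ‖x - y‖ = 2 * Real.sin (sphereDist x y / 2) := by
  rw [← sq_eq_sq₀ (norm_nonneg _) (mul_nonneg two_pos.le (sin_half_sphereDist_nonneg x y)),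
    norm_sub_sq_real, hx, hy, inner_eq_one_sub hx hy]
  ring

theorem norm_add_eq_two_mul_cos (hx : ‖x‖ = 1) (hy : ‖y‖ = 1) :
    ‖x + y‖ = 2 * Real.cos (sphereDist x y / 2) := by
  rw [← sq_eq_sq₀ (norm_nonneg _) (mul_nonneg two_pos.le (cos_half_sphereDist_nonneg x y)),
    norm_add_sq_real, hx, hy, inner_eq_one_sub hx hy, mul_pow, Real.cos_sq']
  ring

theorem norm_sub_le_sphereDist (hx : ‖x‖ = 1) (hy : ‖y‖ = 1) : ‖x - y‖ ≤ sphereDist x y := by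
  rw [norm_sub_eq_two_mul_sin hx hy]
  linarith [Real.sin_le (x := sphereDist x y / 2) (by linarith [sphereDist_nonneg x y])]

theorem sphereDist_le_mul_norm_sub (hx : ‖x‖ = 1) (hy : ‖y‖ = 1) :
    sphereDist x y ≤ Real.pi / 2 * ‖x - y‖ := by
  have h := Real.mul_le_sin (x := sphereDist x y / 2) (by linarith [sphereDist_nonneg x y])
    (by linarith [sphereDist_le_pi x y])
  rw [norm_sub_eq_two_mul_sin hx hy]
  calc sphereDist x y = Real.pi * (2 / Real.pi * (sphereDist x y / 2)) := by
        field_simp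
    _ ≤ Real.pi * Real.sin (sphereDist x y / 2) := by gcongr
    _ = _ := by ring

theorem eq_of_sphereDist_eq_zero (hx : ‖x‖ = 1) (hy : ‖y‖ = 1) (h : sphereDist x y = 0) :
    x = y := by
  have := norm_sub_le_sphereDist hx hy
  rw [h] at this
  exact sub_eq_zero.1 (norm_le_zero_iff.1 this)

/-- The component of `v` orthogonal to the unit vector `x`. -/
noncomputable def tangentPart (x v : Ambient k) : Ambient k := v - inner ℝ x v • x

theorem tangentPart_sub (x v u : Ambient k) :
    tangentPart x (v - u) = tangentPart x v - tangentPart x u := by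
  simp only [tangentPart, inner_sub_right, sub_smul]
  abel

theorem norm_tangentPart_sq (hx : ‖x‖ = 1) (v : Ambient k) :
    ‖tangentPart x v‖ ^ 2 = ‖v‖ ^ 2 - inner ℝ x v ^ 2 := by
  rw [tangentPart, norm_sub_sq_real, norm_smul, real_inner_smul_right, hx, real_inner_comm,
    Real.norm_eq_abs, mul_one, sq_abs]
  ring

theorem norm_tangentPart_le (hx : ‖x‖ = 1) (v : Ambient k) : ‖tangentPart x v‖ ≤ ‖v‖ := by
  rw [← sq_le_sq₀ (norm_nonneg _) (norm_nonneg _), norm_tangentPart_sq hx]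
  linarith [sq_nonneg (inner ℝ x v)]

theorem norm_tangentPart (hx : ‖x‖ = 1) (hy : ‖y‖ = 1) :
    ‖tangentPart x y‖ = Real.sin (sphereDist x y) := by
  rw [← sq_eq_sq₀ (norm_nonneg _) (sin_sphereDist_nonneg x y), norm_tangentPart_sq hx, hy,
    Real.sin_sq, cos_sphereDist hx hy]
  ring

theorem inner_tangentPart_left (x v : Ambient k) (u : Ambient k) :
    inner ℝ (tangentPart x v) u = inner ℝ v u - inner ℝ x v * inner ℝ x u := by
  rw [tangentPart, inner_sub_left, real_inner_smul_left]

theorem inner_self_tangentPart (hx : ‖x‖ = 1) (v : Ambient k) :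
    inner ℝ x (tangentPart x v) = 0 := by
  rw [real_inner_comm, inner_tangentPart_left, real_inner_self_eq_norm_sq, hx, real_inner_comm]
  ring

/-- A tangent vector at `x` sees only the tangential part of `y`, of length `sin d(x, y)`. This
factor later cancels the denominator in the derivative of `arccos`. -/
theorem abs_inner_le_mul_sin {v : Ambient k} (hx : ‖x‖ = 1) (hy : ‖y‖ = 1)
    (hv : inner ℝ x v = 0) : |inner ℝ v y| ≤ ‖v‖ * Real.sin (sphereDist x y) := by
  have h : inner ℝ v y = inner ℝ v (tangentPart x y) := by
    rw [tangentPart, inner_sub_right, real_inner_smul_right, real_inner_comm x v, hv]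
    ring
  rw [h, ← norm_tangentPart hx hy]
  exact abs_real_inner_le_norm _ _

/-- The inverse of the Riemannian exponential map of the sphere at `x`. -/
noncomputable def logMap (x z : Ambient k) : Ambient k := angleRatio (sphereDist x z) • tangentPart x z

theorem inner_self_logMap (hx : ‖x‖ = 1) (z : Ambient k) : inner ℝ x (logMap x z) = 0 := by
  rw [logMap, real_inner_smul_right, inner_self_tangentPart hx, mul_zero]

theorem norm_logMap (hx : ‖x‖ = 1) (hz : ‖z‖ = 1) (h : sphereDist x z < Real.pi) :
    ‖logMap x z‖ = sphereDist x z := by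
  rw [logMap, norm_smul, norm_tangentPart hx hz, Real.norm_eq_abs,
    abs_of_nonneg (angleRatio_nonneg (sphereDist_nonneg x z) h.le),
    angleRatio_mul_sin (sphereDist_nonneg x z) h]

/-- The vector field `x ↦ -∇ₓ K(x, z)` in closed form. -/
noncomputable def pairForce (g : ℝ → ℝ) (x z : Ambient k) : Ambient k :=
  (2 * profileDeriv g (sphereDist x z ^ 2)) • logMap x z

theorem inner_self_pairForce (g : ℝ → ℝ) (hx : ‖x‖ = 1) (z : Ambient k) :
    inner ℝ x (pairForce g x z) = 0 := by
  rw [pairForce, real_inner_smul_right, inner_self_logMap hx, mul_zero]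

/-- A Lipschitz constant of `pairForce` in each variable. -/
noncomputable def forceLip (g : ℝ → ℝ) (ε : ℝ) : ℝ :=
  4 * Real.pi ^ 2 * profileDerivLip g ε +
    2 * profileDerivSup g ε * (ratioSup ε + ratioDerivSup ε)

/-! ### Estimates for the logarithm and the pair force -/

variable {ε : ℝ} {g : ℝ → ℝ}

theorem forceLip_nonneg (hε : 0 < ε) (hε' : ε < Real.pi / 2) : 0 ≤ forceLip g ε := by
  have h1 := ratioSup_nonneg hε hε'
  have h2 := ratioDerivSup_nonneg hε hε'
  have h3 : 0 ≤ profileDerivSup g ε := profileDerivSup_nonneg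
  have h4 : 0 ≤ profileDerivLip g ε := profileDerivLip_nonneg
  unfold forceLip
  positivity

theorem sphereDist_mem_Icc (h : sphereDist x y ≤ Real.pi - 2 * ε) :
    sphereDist x y ∈ Icc 0 (Real.pi - 2 * ε) := ⟨sphereDist_nonneg x y, h⟩

theorem sphereDist_sq_mem_Icc (h : sphereDist x y ≤ Real.pi - 2 * ε) :
    sphereDist x y ^ 2 ∈ Icc 0 ((Real.pi - 2 * ε) ^ 2) :=
  ⟨sq_nonneg _, pow_le_pow_left₀ (sphereDist_nonneg x y) h 2⟩

theorem abs_profileDeriv_sphereDist_sub_le (hg : IsAdmissibleProfile g)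
    (hx : ‖x‖ = 1) (hy : ‖y‖ = 1) (hz : ‖z‖ = 1)
    (hxz : sphereDist x z ≤ Real.pi - 2 * ε) (hyz : sphereDist y z ≤ Real.pi - 2 * ε) :
    |profileDeriv g (sphereDist x z ^ 2) - profileDeriv g (sphereDist y z ^ 2)| ≤
      2 * Real.pi * profileDerivLip g ε * sphereDist x y := by
  have hL : 0 ≤ profileDerivLip g ε := profileDerivLip_nonneg
  have h1 : |sphereDist x z ^ 2 - sphereDist y z ^ 2| ≤ 2 * Real.pi * sphereDist x y := by
    rw [sq_sub_sq, abs_mul, abs_of_nonneg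
      (add_nonneg (sphereDist_nonneg x z) (sphereDist_nonneg y z))]
    exact mul_le_mul (by linarith [sphereDist_le_pi x z, sphereDist_le_pi y z])
      (abs_sphereDist_sub_le hx hy hz) (abs_nonneg _) (by positivity)
  calc _ ≤ profileDerivLip g ε * |sphereDist x z ^ 2 - sphereDist y z ^ 2| :=
        abs_profileDeriv_sub_le hg (sphereDist_sq_mem_Icc hxz) (sphereDist_sq_mem_Icc hyz)
    _ ≤ profileDerivLip g ε * (2 * Real.pi * sphereDist x y) := by gcongr
    _ = _ := by ring

theorem norm_logMap_sub_le (hε : 0 < ε) (hε' : ε < Real.pi / 2)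
    (hx : ‖x‖ = 1) (hz : ‖z‖ = 1) (hw : ‖w‖ = 1)
    (hxz : sphereDist x z ≤ Real.pi - 2 * ε) (hxw : sphereDist x w ≤ Real.pi - 2 * ε) :
    ‖logMap x z - logMap x w‖ ≤ (ratioSup ε + ratioDerivSup ε) * sphereDist z w := by
  have hL := ratioDerivSup_nonneg hε hε'
  have hC := ratioSup_nonneg hε hε'
  have h1 : logMap x z - logMap x w = angleRatio (sphereDist x z) • tangentPart x (z - w) +
      (angleRatio (sphereDist x z) - angleRatio (sphereDist x w)) • tangentPart x w := by
    rw [tangentPart_sub, logMap, logMap, smul_sub, sub_smul]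
    abel
  have h2 : |angleRatio (sphereDist x z)| ≤ ratioSup ε := by
    rw [abs_of_nonneg (angleRatio_nonneg (sphereDist_nonneg x z) (sphereDist_le_pi x z))]
    exact angleRatio_le_ratioSup hε (sphereDist_mem_Icc hxz)
  have h3 : |angleRatio (sphereDist x z) - angleRatio (sphereDist x w)| ≤
      ratioDerivSup ε * sphereDist z w := by
    refine (abs_angleRatio_sub_le hε (sphereDist_mem_Icc hxz)
      (sphereDist_mem_Icc hxw)).trans ?_
    have := abs_sphereDist_sub_le hz hw hx
    rw [sphereDist_comm z x, sphereDist_comm w x] at this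
    gcongr
  have h4 : ‖tangentPart x (z - w)‖ ≤ sphereDist z w :=
    (norm_tangentPart_le hx _).trans (norm_sub_le_sphereDist hz hw)
  have h5 : ‖tangentPart x w‖ ≤ 1 := (norm_tangentPart_le hx _).trans hw.le
  have hd := sphereDist_nonneg z w
  rw [h1]
  calc _ ≤ ‖angleRatio (sphereDist x z)‖ * ‖tangentPart x (z - w)‖ +
        ‖angleRatio (sphereDist x z) - angleRatio (sphereDist x w)‖ * ‖tangentPart x w‖ := by
        rw [← norm_smul, ← norm_smul]
        exact norm_add_le _ _
    _ ≤ ratioSup ε * sphereDist z w + ratioDerivSup ε * sphereDist z w * 1 := by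
        rw [Real.norm_eq_abs, Real.norm_eq_abs]
        gcongr
    _ = _ := by ring

theorem norm_pairForce_sub_le (hε : 0 < ε) (hε' : ε < Real.pi / 2) (hg : IsAdmissibleProfile g)
    (hx : ‖x‖ = 1) (hz : ‖z‖ = 1) (hw : ‖w‖ = 1)
    (hxz : sphereDist x z ≤ Real.pi - 2 * ε) (hxw : sphereDist x w ≤ Real.pi - 2 * ε) :
    ‖pairForce g x z - pairForce g x w‖ ≤ forceLip g ε * sphereDist z w := by
  have hC : 0 ≤ profileDerivSup g ε := profileDerivSup_nonneg
  have hL : 0 ≤ profileDerivLip g ε := profileDerivLip_nonneg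
  have hd := sphereDist_nonneg z w
  set a := profileDeriv g (sphereDist x z ^ 2) with ha
  set b := profileDeriv g (sphereDist x w ^ 2) with hb
  have h1 : pairForce g x z - pairForce g x w =
      (2 * (a - b)) • logMap x z + (2 * b) • (logMap x z - logMap x w) := by
    simp only [pairForce, ← ha, ← hb, mul_sub, sub_smul, smul_sub]
    abel
  have h2 : |a - b| ≤ 2 * Real.pi * profileDerivLip g ε * sphereDist z w := by
    have := abs_profileDeriv_sphereDist_sub_le hg hz hw hx
      (by rwa [sphereDist_comm]) (by rwa [sphereDist_comm])
    rwa [sphereDist_comm z x, sphereDist_comm w x] at this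
  have h3 : ‖logMap x z‖ ≤ Real.pi := by
    rw [norm_logMap hx hz (by linarith)]
    exact sphereDist_le_pi x z
  have h4 : |b| ≤ profileDerivSup g ε := abs_profileDeriv_le hg (sphereDist_sq_mem_Icc hxw)
  have h5 := norm_logMap_sub_le hε hε' hx hz hw hxz hxw
  rw [h1]
  calc _ ≤ 2 * |a - b| * ‖logMap x z‖ + 2 * |b| * ‖logMap x z - logMap x w‖ := by
        refine (norm_add_le _ _).trans_eq ?_
        rw [norm_smul, norm_smul, norm_mul, norm_mul, Real.norm_two, Real.norm_eq_abs,
          Real.norm_eq_abs]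
    _ ≤ 2 * (2 * Real.pi * profileDerivLip g ε * sphereDist z w) * Real.pi +
        2 * profileDerivSup g ε * ((ratioSup ε + ratioDerivSup ε) * sphereDist z w) := by
        gcongr
    _ = _ := by rw [forceLip]; ring

theorem abs_inner_logMap_add_le (hε : 0 < ε) (hε' : ε < Real.pi / 2)
    (hx : ‖x‖ = 1) (hy : ‖y‖ = 1) (hz : ‖z‖ = 1)
    (hxz : sphereDist x z ≤ Real.pi - 2 * ε) (hyz : sphereDist y z ≤ Real.pi - 2 * ε) :
    |inner ℝ (logMap x z) y + inner ℝ (logMap y z) x| ≤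
      (ratioSup ε + ratioDerivSup ε) * sphereDist x y * Real.sin (sphereDist x y) := by
  have hL := ratioDerivSup_nonneg hε hε'
  have hC := ratioSup_nonneg hε hε'
  have hd := sphereDist_nonneg x y
  set s := Real.sin (sphereDist x y / 2) with hs
  set c := Real.cos (sphereDist x y / 2) with hc
  have hs0 : 0 ≤ s := sin_half_sphereDist_nonneg x y
  have hc0 : 0 ≤ c := cos_half_sphereDist_nonneg x y
  have hsc : Real.sin (sphereDist x y) = 2 * s * c := by
    rw [hs, hc, ← Real.sin_two_mul, mul_div_cancel₀ _ two_ne_zero]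
  have hsc1 : s ^ 2 + c ^ 2 = 1 := Real.sin_sq_add_cos_sq _
  have hxy : inner ℝ x y = 1 - 2 * s ^ 2 := inner_eq_one_sub hx hy
  set a := angleRatio (sphereDist x z) with ha
  set b := angleRatio (sphereDist y z) with hb
  have ha1 : |a + b| ≤ 2 * ratioSup ε := by
    have h1 := angleRatio_le_ratioSup hε (sphereDist_mem_Icc hxz)
    have h2 := angleRatio_le_ratioSup hε (sphereDist_mem_Icc hyz)
    rw [abs_of_nonneg (add_nonneg
      (angleRatio_nonneg (sphereDist_nonneg x z) (sphereDist_le_pi x z))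
      (angleRatio_nonneg (sphereDist_nonneg y z) (sphereDist_le_pi y z)))]
    linarith
  have hb1 : |a - b| ≤ ratioDerivSup ε * sphereDist x y := by
    refine (abs_angleRatio_sub_le hε (sphereDist_mem_Icc hxz)
      (sphereDist_mem_Icc hyz)).trans ?_
    have := abs_sphereDist_sub_le hx hy hz
    gcongr
  have h1 : |inner ℝ (x + y) z| ≤ 2 * c := by
    rw [hc, ← norm_add_eq_two_mul_cos hx hy]
    simpa [hz] using abs_real_inner_le_norm (x + y) z
  have h2 : |inner ℝ (x - y) z| ≤ 2 * s := by
    rw [hs, ← norm_sub_eq_two_mul_sin hx hy]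
    simpa [hz] using abs_real_inner_le_norm (x - y) z
  -- Half-angle identity: the bounds `2c` and `2s` for `(x ± y)·z` give both terms a factor `2sc =
  -- sin d(x, y)`. The other factor of order `d(x, y)` comes from the leftover `s` in the first term
  -- and from `a - b` in the second.
  have h3 : inner ℝ (logMap x z) y + inner ℝ (logMap y z) x =
      (a + b) * inner ℝ (x + y) z * s ^ 2 - (a - b) * inner ℝ (x - y) z * c ^ 2 := by
    rw [logMap, logMap, real_inner_smul_left, real_inner_smul_left, inner_tangentPart_left,
      inner_tangentPart_left, ← ha, ← hb, real_inner_comm x y, hxy, inner_add_left, inner_sub_left,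
      real_inner_comm y z, real_inner_comm x z,
      show c ^ 2 = 1 - s ^ 2 by linarith]
    ring
  have h4 : s ≤ sphereDist x y / 2 := Real.sin_le (by linarith)
  have h5 : c ≤ 1 := Real.cos_le_one _
  rw [h3, hsc]
  calc _ ≤ |a + b| * |inner ℝ (x + y) z| * s ^ 2 + |a - b| * |inner ℝ (x - y) z| * c ^ 2 := by
        refine (abs_sub _ _).trans_eq ?_
        simp only [abs_mul, abs_of_nonneg (sq_nonneg s), abs_of_nonneg (sq_nonneg c)]
    _ ≤ 2 * ratioSup ε * (2 * c) * s ^ 2 +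
        ratioDerivSup ε * sphereDist x y * (2 * s) * c ^ 2 := by gcongr
    _ = 2 * ratioSup ε * (2 * c) * s * s +
        ratioDerivSup ε * sphereDist x y * (2 * s) * c * c := by ring
    _ ≤ 2 * ratioSup ε * (2 * c) * s * (sphereDist x y / 2) +
        ratioDerivSup ε * sphereDist x y * (2 * s) * c * 1 := by gcongr
    _ = _ := by ring

theorem abs_inner_pairForce_add_le_of_same_source (hε : 0 < ε) (hε' : ε < Real.pi / 2)
    (hg : IsAdmissibleProfile g) (hx : ‖x‖ = 1) (hy : ‖y‖ = 1) (hz : ‖z‖ = 1)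
    (hxz : sphereDist x z ≤ Real.pi - 2 * ε) (hyz : sphereDist y z ≤ Real.pi - 2 * ε) :
    |inner ℝ (pairForce g x z) y + inner ℝ (pairForce g y z) x| ≤
      forceLip g ε * sphereDist x y * Real.sin (sphereDist x y) := by
  have hC : 0 ≤ profileDerivSup g ε := profileDerivSup_nonneg
  have hL : 0 ≤ profileDerivLip g ε := profileDerivLip_nonneg
  have hd := sphereDist_nonneg x y
  have hsin := sin_sphereDist_nonneg x y
  set a := profileDeriv g (sphereDist x z ^ 2) with ha
  set b := profileDeriv g (sphereDist y z ^ 2) with hb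
  have h1 : inner ℝ (pairForce g x z) y + inner ℝ (pairForce g y z) x =
      2 * ((a - b) * inner ℝ (logMap x z) y) +
        2 * (b * (inner ℝ (logMap x z) y + inner ℝ (logMap y z) x)) := by
    rw [pairForce, pairForce, real_inner_smul_left, real_inner_smul_left]
    ring
  have h2 : |a - b| ≤ 2 * Real.pi * profileDerivLip g ε * sphereDist x y :=
    abs_profileDeriv_sphereDist_sub_le hg hx hy hz hxz hyz
  have h3 : |inner ℝ (logMap x z) y| ≤ Real.pi * Real.sin (sphereDist x y) := by
    refine (abs_inner_le_mul_sin hx hy (inner_self_logMap hx z)).trans ?_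
    rw [norm_logMap hx hz (by linarith)]
    have := sphereDist_le_pi x z
    gcongr
  have h4 : |b| ≤ profileDerivSup g ε := abs_profileDeriv_le hg (sphereDist_sq_mem_Icc hyz)
  have h5 := abs_inner_logMap_add_le hε hε' hx hy hz hxz hyz
  rw [h1]
  calc _ ≤ 2 * (|a - b| * |inner ℝ (logMap x z) y|) +
        2 * (|b| * |inner ℝ (logMap x z) y + inner ℝ (logMap y z) x|) := by
        refine (abs_add_le _ _).trans_eq ?_
        simp only [abs_mul, abs_two]
    _ ≤ 2 * ((2 * Real.pi * profileDerivLip g ε * sphereDist x y) *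
          (Real.pi * Real.sin (sphereDist x y))) +
        2 * (profileDerivSup g ε * ((ratioSup ε + ratioDerivSup ε) * sphereDist x y *
          Real.sin (sphereDist x y))) := by
        gcongr
    _ = _ := by rw [forceLip]; ring

/-- Compare first with a common source `z`, then exchange `z` for `w` in the force at `y`; the
change is tangent at `y`, so its product with `x` keeps the factor `sin d(x, y)`. -/
theorem abs_inner_pairForce_add_le (hε : 0 < ε) (hε' : ε < Real.pi / 2)
    (hg : IsAdmissibleProfile g) (hx : ‖x‖ = 1) (hy : ‖y‖ = 1) (hz : ‖z‖ = 1) (hw : ‖w‖ = 1)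
    (hxz : sphereDist x z ≤ Real.pi - 2 * ε) (hyz : sphereDist y z ≤ Real.pi - 2 * ε)
    (hyw : sphereDist y w ≤ Real.pi - 2 * ε) :
    |inner ℝ (pairForce g x z) y + inner ℝ (pairForce g y w) x| ≤
      Real.sin (sphereDist x y) *
        (forceLip g ε * sphereDist x y + forceLip g ε * sphereDist z w) := by
  have hsin := sin_sphereDist_nonneg x y
  have h1 := abs_inner_pairForce_add_le_of_same_source hε hε' hg hx hy hz hxz hyz
  have h2 : |inner ℝ (pairForce g y w - pairForce g y z) x| ≤
      forceLip g ε * sphereDist z w * Real.sin (sphereDist x y) := by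
    refine (abs_inner_le_mul_sin hy hx ?_).trans ?_
    · rw [inner_sub_right, inner_self_pairForce g hy, inner_self_pairForce g hy, sub_zero]
    · rw [sphereDist_comm y x, norm_sub_rev]
      gcongr
      exact norm_pairForce_sub_le hε hε' hg hy hz hw hyz hyw
  have h3 : inner ℝ (pairForce g x z) y + inner ℝ (pairForce g y w) x =
      (inner ℝ (pairForce g x z) y + inner ℝ (pairForce g y z) x) +
        inner ℝ (pairForce g y w - pairForce g y z) x := by
    rw [inner_sub_left]
    ring
  rw [h3]
  refine (abs_add_le _ _).trans ?_
  linarith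

end Geometry

/-! ### The velocity field in closed form -/

section Gradient

variable {k : ℕ} {x y : Ambient k}

theorem hasFDerivAt_inner_normalize (hx : ‖x‖ = 1) (y : Ambient k) :
    HasFDerivAt (fun z : Ambient k => inner ℝ (‖z‖⁻¹ • z) y) (innerSL ℝ (tangentPart x y)) x := by
  have h1 : HasFDerivAt (fun z : Ambient k => ‖z‖) (innerSL ℝ x) x := by
    have h := (hasStrictFDerivAt_norm_sq x).hasFDerivAt.sqrt (by simp [hx])
    simp only [Real.sqrt_sq (norm_nonneg _), hx] at h
    refine h.congr_fderiv ?_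
    ext v
    simp
  have h2 : HasFDerivAt (fun z : Ambient k => inner ℝ y z) (innerSL ℝ y) x :=
    (innerSL ℝ y).hasFDerivAt
  have h3 := ((hasDerivAt_inv (by simp [hx] : ‖x‖ ≠ 0)).comp_hasFDerivAt x h1).mul h2
  refine (h3.congr_fderiv ?_).congr_of_eventuallyEq (.of_forall fun z => ?_)
  · ext v
    simp [hx, tangentPart, real_inner_comm x y]
    ring
  · simp [real_inner_smul_left, real_inner_comm z y]

theorem hasFDerivAt_sphereDist_sq_normalize (hx : ‖x‖ = 1) (hy : ‖y‖ = 1)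
    (hxy : sphereDist x y < Real.pi) :
    HasFDerivAt (fun z : Ambient k => sphereDist (‖z‖⁻¹ • z) y ^ 2)
      (innerSL ℝ ((-2 : ℝ) • logMap x y)) x := by
  have hx0 : x ≠ 0 := norm_ne_zero_iff.1 (by simp [hx])
  by_cases h : x = y
  · subst h
    have h0 : logMap x x = 0 := by
      rw [logMap, tangentPart, real_inner_self_eq_norm_sq, hx]
      simp
    rw [h0, smul_zero, map_zero]
    have hn : DifferentiableAt ℝ (fun z : Ambient k => ‖z‖⁻¹ • z) x :=
      ((differentiableAt_id.norm ℝ hx0).inv (by simp [hx])).smul differentiableAt_id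
    have h1 := hn.hasFDerivAt.isBigO_sub
    simp only [hx, inv_one, one_smul] at h1
    -- On the diagonal `arccos` is not differentiable, but the squared distance is at most a
    -- multiple of the squared chord, hence quadratically small, and its derivative vanishes.
    refine Asymptotics.IsBigO.hasFDerivAt (n := 2) ?_ one_lt_two
    refine Asymptotics.IsBigO.trans ?_ (h1.norm_norm.pow 2)
    refine Asymptotics.IsBigO.of_bound ((Real.pi / 2) ^ 2) ?_
    filter_upwards [eventually_ne_nhds hx0] with z hz
    have hz1 : ‖(‖z‖⁻¹ • z)‖ = 1 := norm_smul_inv_norm hz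
    rw [Real.norm_of_nonneg (sq_nonneg _), Real.norm_of_nonneg (sq_nonneg _), ← mul_pow]
    exact pow_le_pow_left₀ (sphereDist_nonneg _ _) (sphereDist_le_mul_norm_sub hz1 hx) 2
  · have hd0 : 0 < sphereDist x y :=
      (sphereDist_nonneg x y).lt_of_ne fun h0 => h (eq_of_sphereDist_eq_zero hx hy h0.symm)
    have hsin := Real.sin_pos_of_pos_of_lt_pi hd0 hxy
    have hcos := cos_sphereDist hx hy
    have hlt : inner ℝ x y ^ 2 < 1 := by
      rw [← hcos, Real.cos_sq']
      linarith [sq_pos_of_pos hsin]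
    have hu : inner ℝ (‖x‖⁻¹ • x) y = inner ℝ x y := by simp [hx]
    have h1 := Real.hasDerivAt_arccos (x := inner ℝ (‖x‖⁻¹ • x) y) (by rw [hu]; nlinarith)
      (by rw [hu]; nlinarith)
    have h2 := (h1.comp_hasFDerivAt x (hasFDerivAt_inner_normalize hx y)).pow 2
    refine h2.congr_fderiv ?_
    have hs : √(1 - inner ℝ x y ^ 2) = Real.sin (sphereDist x y) := by
      rw [← hcos, ← Real.sin_sq, Real.sqrt_sq hsin.le]
    ext v
    simp only [hu, hs, logMap, angleRatio, if_neg hd0.ne', Function.comp_apply]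
    simp only [smul_apply, innerSL_apply_apply, real_inner_smul_left,
      smul_eq_mul]
    rw [show Real.arccos (inner ℝ x y) = sphereDist x y from rfl]
    simp
    field_simp

theorem sphereGradient_potential {g : ℝ → ℝ} (hg : IsAdmissibleProfile g) (hx : ‖x‖ = 1)
    (hy : ‖y‖ = 1) (hxy : sphereDist x y < Real.pi) :
    sphereGradient (fun z => potential g z y) x = -pairForce g x y := by
  have h1 := hasFDerivAt_sphereDist_sq_normalize hx hy hxy
  have h2 : HasDerivWithinAt g (profileDeriv g (sphereDist x y ^ 2)) (Ici 0)
      (sphereDist x y ^ 2) :=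
    (hg.differentiableOn _ (sq_nonneg (sphereDist x y))).hasDerivWithinAt
  -- The one-sided derivative of `g` at `0` suffices, since squared distances stay in `[0, ∞)`.
  have h3 := h2.comp_hasFDerivAt_of_eq x h1 (.of_forall fun z => mem_Ici.2 (sq_nonneg _)) (by simp [hx])
  apply HasGradientAt.gradient
  rw [hasGradientAt_iff_hasFDerivAt]
  refine h3.congr_fderiv ?_
  ext v
  simp [pairForce]
  ring

end Gradient

/-! ### Forces and velocities on the disk -/

section Disk

variable {k : ℕ} {ε : ℝ}

theorem norm_coe_disk (x : disk k ε) : ‖(x : Ambient k)‖ = 1 := by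
  simpa using x.2.1

theorem sphereDist_disk_le (x y : disk k ε) :
    sphereDist (x : Ambient k) y ≤ Real.pi - 2 * ε := by
  have hN : ‖northPole k‖ = 1 := by simp [northPole]
  have h := sphereDist_triangle (norm_coe_disk x) hN (norm_coe_disk y)
  have h1 := x.2.2
  have h2 := y.2.2
  rw [sphereDist_comm (northPole k)] at h
  linarith

theorem continuous_sphereDist_disk :
    Continuous fun p : disk k ε × disk k ε => sphereDist (p.1 : Ambient k) (p.2 : Ambient k) := by
  have h1 : Continuous fun p : disk k ε × disk k ε => (p.1 : Ambient k) :=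
    continuous_subtype_val.comp continuous_fst
  have h2 : Continuous fun p : disk k ε × disk k ε => (p.2 : Ambient k) :=
    continuous_subtype_val.comp continuous_snd
  exact Real.continuous_arccos.comp (h1.inner h2)

variable {g : ℝ → ℝ}

theorem continuous_pairForce (hε : 0 < ε) (hε' : ε < Real.pi / 2) (hg : IsAdmissibleProfile g)
    (x : disk k ε) : Continuous fun y : disk k ε => pairForce g (x : Ambient k) y := by
  refine (LipschitzWith.of_dist_le_mul (K := (forceLip g ε * (Real.pi / 2)).toNNReal)
    fun y z => ?_).continuous
  rw [dist_eq_norm, Subtype.dist_eq, dist_eq_norm]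
  refine (norm_pairForce_sub_le hε hε' hg (norm_coe_disk x) (norm_coe_disk y) (norm_coe_disk z)
    (sphereDist_disk_le x y) (sphereDist_disk_le x z)).trans ?_
  rw [Real.coe_toNNReal _ (mul_nonneg (forceLip_nonneg hε hε') Real.pi_div_two_pos.le), mul_assoc]
  exact mul_le_mul_of_nonneg_left
    (sphereDist_le_mul_norm_sub (norm_coe_disk y) (norm_coe_disk z)) (forceLip_nonneg hε hε')

theorem norm_pairForce_le (hε : 0 < ε) (hg : IsAdmissibleProfile g) (x y : disk k ε) :
    ‖pairForce g (x : Ambient k) y‖ ≤ 2 * profileDerivSup g ε * Real.pi := by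
  have hd := sphereDist_disk_le x y
  rw [pairForce, norm_smul, norm_logMap (norm_coe_disk x) (norm_coe_disk y) (by linarith),
    norm_mul, Real.norm_two, Real.norm_eq_abs]
  have h1 := abs_profileDeriv_le hg (sphereDist_sq_mem_Icc hd)
  have h2 := sphereDist_le_pi (x : Ambient k) y
  have h3 := sphereDist_nonneg (x : Ambient k) y
  have h4 : 0 ≤ profileDerivSup g ε := profileDerivSup_nonneg
  gcongr

theorem velocity_eq_integral_pairForce (hε : 0 < ε) (hg : IsAdmissibleProfile g)
    (μ : ProbabilityMeasure (disk k ε)) (x : disk k ε) :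
    velocity g μ x = ∫ y : disk k ε, pairForce g (x : Ambient k) y ∂(μ : Measure (disk k ε)) := by
  rw [velocity, ← integral_neg]
  congr 1 with y : 1
  rw [sphereGradient_potential hg (norm_coe_disk x) (norm_coe_disk y)
    (by linarith [sphereDist_disk_le x y]), neg_neg]

variable {Ω : Type*} [MeasurableSpace Ω] {P : Measure Ω} [IsProbabilityMeasure P]

theorem integrable_pairForce (hε : 0 < ε) (hε' : ε < Real.pi / 2) (hg : IsAdmissibleProfile g)
    (x : disk k ε) {Z : Ω → disk k ε} (hZ : AEMeasurable Z P) :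
    Integrable (fun q => pairForce g (x : Ambient k) (Z q)) P :=
  Integrable.of_bound
    ((continuous_pairForce hε hε' hg x).measurable.comp_aemeasurable hZ).aestronglyMeasurable
    (2 * profileDerivSup g ε * Real.pi) (.of_forall fun q => norm_pairForce_le hε hg x (Z q))

theorem integrable_sphereDist {Z W : Ω → disk k ε} (hZ : AEMeasurable Z P)
    (hW : AEMeasurable W P) :
    Integrable (fun q => sphereDist (Z q : Ambient k) (W q)) P :=
  Integrable.of_bound (continuous_sphereDist_disk.measurable.comp_aemeasurable
    (hZ.prodMk hW)).aestronglyMeasurable Real.pi (.of_forall fun q => by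
      rw [Real.norm_of_nonneg (sphereDist_nonneg _ _)]
      exact sphereDist_le_pi _ _)

/-- Writing both velocities over one probability space `P` couples their sources, so the pairwise
estimate can be integrated; the mean of `d(Z, W)` becomes the mean-field term. -/
theorem abs_inner_integral_pairForce_add_le (hε : 0 < ε) (hε' : ε < Real.pi / 2)
    (hg : IsAdmissibleProfile g) (x y : disk k ε) {Z W : Ω → disk k ε} (hZ : AEMeasurable Z P)
    (hW : AEMeasurable W P) :
    |inner ℝ (∫ q, pairForce g (x : Ambient k) (Z q) ∂P) (y : Ambient k) +
        inner ℝ (∫ q, pairForce g (y : Ambient k) (W q) ∂P) (x : Ambient k)| ≤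
      Real.sin (sphereDist (x : Ambient k) y) * (forceLip g ε * sphereDist (x : Ambient k) y +
        forceLip g ε * ∫ q, sphereDist (Z q : Ambient k) (W q) ∂P) := by
  have hx := integrable_pairForce hε hε' hg x hZ
  have hy := integrable_pairForce hε hε' hg y hW
  have hd := integrable_sphereDist hZ hW
  rw [real_inner_comm, real_inner_comm (x : Ambient k), ← integral_inner hx, ← integral_inner hy,
    ← integral_add (hx.const_inner _) (hy.const_inner _)]
  refine (abs_integral_le_integral_abs).trans ?_
  calc _ ≤ ∫ q, Real.sin (sphereDist (x : Ambient k) y) *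
        (forceLip g ε * sphereDist (x : Ambient k) y +
          forceLip g ε * sphereDist (Z q : Ambient k) (W q)) ∂P := by
        refine integral_mono ((hx.const_inner _).add (hy.const_inner _)).abs
          (((integrable_const _).add (hd.const_mul _)).const_mul _) fun q => ?_
        have := abs_inner_pairForce_add_le hε hε' hg (norm_coe_disk x) (norm_coe_disk y)
          (norm_coe_disk (Z q)) (norm_coe_disk (W q)) (sphereDist_disk_le x (Z q))
          (sphereDist_disk_le y (Z q)) (sphereDist_disk_le y (W q))
        simpa only [real_inner_comm] using this
    _ = _ := by
        rw [integral_const_mul, integral_add (integrable_const _) (hd.const_mul _)]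
        simp [integral_const_mul]

/-! ### The geodesic distance along a pair of curves -/

theorem hasDerivWithinAt_sphereDist (hε : 0 < ε) {X Y : ℝ → disk k ε} {V W : Ambient k}
    {s : Set ℝ} {t : ℝ} (hX : HasDerivWithinAt (fun r => (X r : Ambient k)) V s t)
    (hY : HasDerivWithinAt (fun r => (Y r : Ambient k)) W s t)
    (h : 0 < sphereDist (X t : Ambient k) (Y t)) :
    HasDerivWithinAt (fun r => sphereDist (X r : Ambient k) (Y r))
      (-(inner ℝ V (Y t : Ambient k) + inner ℝ W (X t : Ambient k)) /
        Real.sin (sphereDist (X t : Ambient k) (Y t))) s t := by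
  have hcos := cos_sphereDist (norm_coe_disk (X t)) (norm_coe_disk (Y t))
  have hsin := Real.sin_pos_of_pos_of_lt_pi h (by linarith [sphereDist_disk_le (X t) (Y t)])
  have hs : √(1 - inner ℝ (X t : Ambient k) (Y t : Ambient k) ^ 2) =
      Real.sin (sphereDist (X t : Ambient k) (Y t)) := by
    rw [← hcos, ← Real.sin_sq, Real.sqrt_sq hsin.le]
  have hlt : inner ℝ (X t : Ambient k) (Y t : Ambient k) ^ 2 < 1 := by
    rw [← hcos, Real.cos_sq']
    linarith [sq_pos_of_pos hsin]
  have h1 := Real.hasDerivAt_arccos (x := inner ℝ (X t : Ambient k) (Y t : Ambient k))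
    (by nlinarith) (by nlinarith)
  refine (h1.comp_hasDerivWithinAt t (hX.inner ℝ hY)).congr_deriv ?_
  rw [hs, real_inner_comm W]
  ring

/-- At a collision the distance need not be differentiable, but it is at most `π/2` times the chord,
whose right slopes are eventually below `‖V - W‖ + 1`. -/
theorem exists_eventually_slope_sphereDist_lt {X Y : ℝ → disk k ε} {V W : Ambient k} {t : ℝ}
    (hX : HasDerivWithinAt (fun r => (X r : Ambient k)) V (Ici t) t)
    (hY : HasDerivWithinAt (fun r => (Y r : Ambient k)) W (Ici t) t)
    (h : sphereDist (X t : Ambient k) (Y t) = 0) :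
    ∃ K, ∀ᶠ r in nhdsWithin t (Ioi t),
      slope (fun r => sphereDist (X r : Ambient k) (Y r)) t r < K := by
  have hXY := eq_of_sphereDist_eq_zero (norm_coe_disk (X t)) (norm_coe_disk (Y t)) h
  refine ⟨Real.pi / 2 * (‖V - W‖ + 1), ?_⟩
  have h1 := ((hX.sub hY).mono Ioi_subset_Ici_self).limsup_norm_slope_le (lt_add_one _)
  filter_upwards [h1, self_mem_nhdsWithin] with r hr hrt
  have hrt' : 0 < r - t := sub_pos.2 hrt
  simp only [Pi.sub_apply, hXY, sub_self, sub_zero, Real.norm_of_nonneg hrt'.le] at hr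
  rw [slope_def_field, h, sub_zero, div_eq_inv_mul]
  have h2 := sphereDist_le_mul_norm_sub (norm_coe_disk (X r)) (norm_coe_disk (Y r))
  calc _ ≤ (r - t)⁻¹ * (Real.pi / 2 * ‖(X r : Ambient k) - Y r‖) := by gcongr
    _ = Real.pi / 2 * ((r - t)⁻¹ * ‖(X r : Ambient k) - Y r‖) := by ring
    _ < _ := by
      have := Real.pi_pos
      gcongr

end Disk

/-! ### A Grönwall inequality with a mean-field term -/

section Gronwall

open Filter Topology

theorem le_exp_mul_of_deriv_le {f e : ℝ → ℝ} {τ a b : ℝ} (hb : 0 ≤ b) (he : Continuous e)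
    (he0 : ∀ t, 0 ≤ e t) (hf : ContinuousOn f (Icc 0 τ)) (hf0 : 0 ≤ f 0)
    (hz : ∀ t ∈ Ico 0 τ, f t = 0 → ∃ K, ∀ᶠ s in 𝓝[>] t, slope f t s < K)
    (hd : ∀ t ∈ Ico 0 τ, f t ≠ 0 → ∃ d, HasDerivWithinAt f d (Ici t) t ∧ d ≤ a * f t + b * e t) :
    ∀ t ∈ Icc 0 τ, f t ≤ Real.exp (a * t) *
      (f 0 + b * ∫ s in (0 : ℝ)..t, Real.exp (-(a * s)) * e s) := by
  have hex : ∀ t, ∃ d, t ∈ Ico 0 τ → (∀ r, d < r → ∃ᶠ s in 𝓝[>] t, slope f t s < r) ∧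
      (f t ≠ 0 → d ≤ a * f t + b * e t) := by
    intro t
    by_cases ht : t ∈ Ico 0 τ
    · by_cases h0 : f t = 0
      · obtain ⟨K, hK⟩ := hz t ht h0
        exact ⟨K, fun _ => ⟨fun r hr => (hK.mono fun s hs => hs.trans hr).frequently,
          fun h => (h h0).elim⟩⟩
      · obtain ⟨d, h1, h2⟩ := hd t ht h0
        exact ⟨d, fun _ => ⟨fun r hr => h1.liminf_right_slope_le hr, fun _ => h2⟩⟩
    · exact ⟨0, fun h => (ht h).elim⟩
  choose d hd' using hex
  have hcont : Continuous fun s => Real.exp (-(a * s)) * e s := by fun_prop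
  set H : ℝ → ℝ := fun t => ∫ s in (0 : ℝ)..t, Real.exp (-(a * s)) * e s with hH
  have hHd : ∀ t, HasDerivAt H (Real.exp (-(a * t)) * e t) t := fun t =>
    hcont.integral_hasStrictDerivAt 0 t |>.hasDerivAt
  -- The term `δ (1 + t)` makes the barrier positive even if `f 0 = 0`, and its growth makes the
  -- derivative inequality strict; `δ` then tends to `0`.
  have key : ∀ δ > 0, ∀ t ∈ Icc 0 τ,
      f t ≤ Real.exp (a * t) * (f 0 + δ * (1 + t) + b * H t) := by
    intro δ hδ t ht
    have hB : ∀ t, HasDerivAt (fun t => Real.exp (a * t) * (f 0 + δ * (1 + t) + b * H t))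
        (a * (Real.exp (a * t) * (f 0 + δ * (1 + t) + b * H t)) + b * e t
          + δ * Real.exp (a * t)) t := by
      intro t
      have h1 : HasDerivAt (fun t => Real.exp (a * t)) (Real.exp (a * t) * a) t := by
        simpa using ((hasDerivAt_id t).const_mul a).exp
      have h2 : HasDerivAt (fun t : ℝ => f 0 + δ * (1 + t)) δ t := by
        simpa using (((hasDerivAt_id t).const_add 1).const_mul δ).const_add (f 0)
      refine (h1.mul (h2.add ((hHd t).const_mul b))).congr_deriv ?_
      have : Real.exp (a * t) * Real.exp (-(a * t)) = 1 := by
        rw [← Real.exp_add, add_neg_cancel, Real.exp_zero]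
      simp only [Pi.add_apply]
      linear_combination (b * e t) * this
    refine image_le_of_liminf_slope_right_lt_deriv_boundary hf
      (fun x hx => (hd' x hx).1) ?_ hB (fun x hx hfx => ?_) ht
    · simp [hH, hδ.le]
    · have hpos : 0 < f x := by
        rw [hfx]
        have : 0 ≤ H x := intervalIntegral.integral_nonneg hx.1 fun s _ =>
          mul_nonneg (Real.exp_pos _).le (he0 s)
        have := hx.1
        positivity
      rw [← hfx]
      have := (hd' x hx).2 hpos.ne'
      have : 0 < δ * Real.exp (a * x) := by positivity
      linarith
  intro t ht
  refine le_of_forall_pos_le_add fun η hη => ?_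
  have hQ : 0 < Real.exp (a * t) * (1 + t) := mul_pos (Real.exp_pos _) (by linarith [ht.1])
  refine (key (η / (Real.exp (a * t) * (1 + t))) (div_pos hη hQ) t ht).trans_eq ?_
  have h1t : (1 + t) ≠ 0 := by linarith [ht.1]
  field_simp
  ring

theorem le_exp_mul_of_le_integral {e : ℝ → ℝ} {τ a b c : ℝ} (hb : 0 ≤ b) (he : Continuous e)
    (he0 : ∀ t, 0 ≤ e t) (hc : 0 ≤ c)
    (h : ∀ t ∈ Icc 0 τ, e t ≤ Real.exp (a * t) *
      (c + b * ∫ s in (0 : ℝ)..t, Real.exp (-(a * s)) * e s)) :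
    ∀ t ∈ Icc 0 τ, e t ≤ Real.exp ((a + b) * t) * c := by
  have hcont : Continuous fun s => Real.exp (-(a * s)) * e s := by fun_prop
  set H : ℝ → ℝ := fun t => ∫ s in (0 : ℝ)..t, Real.exp (-(a * s)) * e s with hH
  have hF : ∀ t, HasDerivAt (fun t => c + b * H t) (b * (Real.exp (-(a * t)) * e t)) t := fun t =>
    (((hcont.integral_hasStrictDerivAt 0 t).hasDerivAt).const_mul b).const_add c
  have hF0 : ∀ t, 0 ≤ t → 0 ≤ c + b * H t := fun t ht =>
    add_nonneg hc (mul_nonneg hb (intervalIntegral.integral_nonneg ht fun s _ =>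
      mul_nonneg (Real.exp_pos _).le (he0 s)))
  intro t ht
  have hG := norm_le_gronwallBound_of_norm_deriv_right_le (f := fun t => c + b * H t)
    (δ := c) (K := b) (ε := 0) (a := 0) (b := τ)
    (fun x _ => (hF x).continuousAt.continuousWithinAt)
    (fun x _ => (hF x).hasDerivWithinAt) (by simp [hH, abs_of_nonneg hc]) (fun x hx => by
      rw [Real.norm_of_nonneg (hF0 x hx.1), Real.norm_of_nonneg
        (mul_nonneg hb (mul_nonneg (Real.exp_pos _).le (he0 x))), add_zero]
      refine mul_le_mul_of_nonneg_left ?_ hb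
      rw [Real.exp_neg, inv_mul_le_iff₀ (Real.exp_pos _)]
      exact h x (Ico_subset_Icc_self hx)) t ht
  rw [gronwallBound_ε0, sub_zero, Real.norm_of_nonneg (hF0 t ht.1)] at hG
  calc e t ≤ Real.exp (a * t) * (c + b * H t) := h t ht
    _ ≤ Real.exp (a * t) * (c * Real.exp (b * t)) := by gcongr
    _ = _ := by rw [add_mul, Real.exp_add]; ring

/-- Each path is first solved with the mean as a given forcing, and the resulting integral
inequality is averaged. The mean itself is never differentiated; it need only be continuous, which
is dominated convergence. -/
theorem integral_le_exp_mul_of_deriv_le {Ω : Type*} [MeasurableSpace Ω] {P : Measure Ω}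
    [IsProbabilityMeasure P] {τ a b M : ℝ} {D : ℝ → Ω → ℝ} (hτ : 0 ≤ τ) (hb : 0 ≤ b)
    (hD0 : ∀ t q, 0 ≤ D t q) (hDM : ∀ t q, D t q ≤ M)
    (hm : ∀ t ∈ Icc 0 τ, AEStronglyMeasurable (D t) P)
    (hc : ∀ᵐ q ∂P, ContinuousOn (fun t => D t q) (Icc 0 τ))
    (hz : ∀ᵐ q ∂P, ∀ t ∈ Ico 0 τ, D t q = 0 →
      ∃ K, ∀ᶠ s in 𝓝[>] t, slope (fun s => D s q) t s < K)
    (hd : ∀ᵐ q ∂P, ∀ t ∈ Ico 0 τ, D t q ≠ 0 →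
      ∃ d, HasDerivWithinAt (fun s => D s q) d (Ici t) t ∧ d ≤ a * D t q + b * ∫ p, D t p ∂P) :
    ∀ t ∈ Icc 0 τ, ∫ q, D t q ∂P ≤ Real.exp ((a + b) * t) * ∫ q, D 0 q ∂P := by
  have hn : ∀ t q, ‖D t q‖ ≤ M := fun t q => by
    rw [Real.norm_of_nonneg (hD0 t q)]
    exact hDM t q
  have hE : ContinuousOn (fun t => ∫ q, D t q ∂P) (Icc 0 τ) :=
    continuousOn_of_dominated (bound := fun _ => M) hm (fun t _ => .of_forall (hn t))
      (integrable_const M) hc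
  have hi : ∀ t ∈ Icc 0 τ, Integrable (D t) P := fun t ht =>
    Integrable.of_bound (hm t ht) M (.of_forall (hn t))
  -- Constant extension beyond the endpoints gives a globally continuous forcing, as the two scalar
  -- lemmas require.
  set e : ℝ → ℝ := IccExtend hτ ((Icc 0 τ).domRestrict fun t => ∫ q, D t q ∂P) with he
  have hec : Continuous e := (continuousOn_iff_continuous_domRestrict.1 hE).Icc_extend'
  have he0 : ∀ t, 0 ≤ e t := fun t => integral_nonneg (hD0 _)
  have heq : ∀ t ∈ Icc 0 τ, e t = ∫ q, D t q ∂P := fun t ht => by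
    rw [he, IccExtend_of_mem _ _ ht]
    rfl
  intro t ht
  rw [← heq t ht]
  refine le_exp_mul_of_le_integral hb hec he0 (integral_nonneg (hD0 _)) (fun t ht => ?_) t ht
  rw [heq t ht]
  have h0 : (0 : ℝ) ∈ Icc 0 τ := ⟨le_rfl, hτ⟩
  calc ∫ q, D t q ∂P ≤ ∫ q, Real.exp (a * t) *
        (D 0 q + b * ∫ s in (0 : ℝ)..t, Real.exp (-(a * s)) * e s) ∂P := by
        refine integral_mono_ae (hi t ht)
          (((hi 0 h0).add (integrable_const _)).const_mul _) ?_
        filter_upwards [hc, hz, hd] with q hcq hzq hdq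
        refine le_exp_mul_of_deriv_le hb hec he0 hcq (hD0 0 q) hzq (fun t ht h => ?_) t ht
        rw [heq t (Ico_subset_Icc_self ht)]
        exact hdq t ht h
    _ = _ := by
        rw [integral_const_mul, integral_add (hi 0 h0) (integrable_const _)]
        simp

end Gronwall

/-! ### Transport of plans by the flows -/

section Transport

variable {k : ℕ} {ε : ℝ} {g : ℝ → ℝ} {T : EReal}

theorem bddBelow_transportCost (μ ν : ProbabilityMeasure (disk k ε)) :
    BddBelow ((fun π : ProbabilityMeasure (disk k ε × disk k ε) =>
      ∫ p, sphereDist (p.1 : Ambient k) (p.2 : Ambient k)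
        ∂(π : Measure (disk k ε × disk k ε))) '' transportPlans μ ν) := by
  refine ⟨0, ?_⟩
  rintro _ ⟨π, -, rfl⟩
  exact integral_nonneg fun p => sphereDist_nonneg _ _

theorem wasserstein_nonneg (μ ν : ProbabilityMeasure (disk k ε)) : 0 ≤ wasserstein μ ν := by
  apply Real.sInf_nonneg
  rintro _ ⟨π, -, rfl⟩
  exact integral_nonneg fun p => sphereDist_nonneg _ _

theorem transportPlans_nonempty (μ ν : ProbabilityMeasure (disk k ε)) :
    (transportPlans μ ν).Nonempty :=
  ⟨μ.prod ν, by simp [ProbabilityMeasure.toMeasure_prod],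
    by simp [ProbabilityMeasure.toMeasure_prod]⟩

theorem wasserstein_le_of_maps {Ω : Type*} [MeasurableSpace Ω] {P : Measure Ω}
    [IsProbabilityMeasure P] {μ ν : ProbabilityMeasure (disk k ε)} {Z W : Ω → disk k ε}
    (hZ : AEMeasurable Z P) (hW : AEMeasurable W P) (hμ : (μ : Measure (disk k ε)) = P.map Z)
    (hν : (ν : Measure (disk k ε)) = P.map W) :
    wasserstein μ ν ≤ ∫ q, sphereDist (Z q : Ambient k) (W q) ∂P := by
  have hZW : AEMeasurable (fun q => (Z q, W q)) P := hZ.prodMk hW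
  have := Measure.isProbabilityMeasure_map hZW
  refine csInf_le (bddBelow_transportCost μ ν) ⟨⟨P.map fun q => (Z q, W q), this⟩, ⟨?_, ?_⟩, ?_⟩
  · rw [ProbabilityMeasure.coe_mk, AEMeasurable.map_map_of_aemeasurable
      measurable_fst.aemeasurable hZW, hμ]
    rfl
  · rw [ProbabilityMeasure.coe_mk, AEMeasurable.map_map_of_aemeasurable
      measurable_snd.aemeasurable hZW, hν]
    rfl
  · exact integral_map hZW continuous_sphereDist_disk.aestronglyMeasurable

/-- Otherwise `Measure.map` takes its default value `0`, which is not a probability measure. -/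
theorem aemeasurable_of_map_eq {μ ν : ProbabilityMeasure (disk k ε)} {F : disk k ε → disk k ε}
    (h : (ν : Measure (disk k ε)) = (μ : Measure (disk k ε)).map F) :
    AEMeasurable F (μ : Measure (disk k ε)) := by
  by_contra hF
  rw [Measure.map_of_not_aemeasurable hF] at h
  exact IsProbabilityMeasure.ne_zero (ν : Measure (disk k ε)) h

theorem velocity_eq_integral_of_map_eq (hε : 0 < ε) (hε' : ε < Real.pi / 2)
    (hg : IsAdmissibleProfile g) {Ω : Type*} [MeasurableSpace Ω] {P : Measure Ω}
    {μ : ProbabilityMeasure (disk k ε)} {Z : Ω → disk k ε}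
    (hZ : AEMeasurable Z P) (hμ : (μ : Measure (disk k ε)) = P.map Z) (x : disk k ε) :
    velocity g μ x = ∫ q, pairForce g (x : Ambient k) (Z q) ∂P := by
  rw [velocity_eq_integral_pairForce hε hg, hμ,
    integral_map hZ (continuous_pairForce hε hε' hg x).aestronglyMeasurable]

/-- Since `T` is excluded, the flow equation yields right derivatives at every time, including `0`.
-/
theorem timeInterval_mem_nhdsGE {t : ℝ} (ht : t ∈ timeInterval T) :
    timeInterval T ∈ nhdsWithin t (Ici t) := by
  obtain ⟨τ, h1, h2⟩ := EReal.lt_iff_exists_real_btwn.1 ht.2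
  filter_upwards [Ico_mem_nhdsGE (EReal.coe_lt_coe_iff.1 h1)] with s hs
  exact ⟨ht.1.trans hs.1, (EReal.coe_lt_coe_iff.2 hs.2).trans h2⟩

theorem IsFlowMap.hasDerivWithinAt_Ici {X : disk k ε → ℝ → Ambient k} {A : Set (disk k ε)}
    {Ψ : disk k ε → ℝ → disk k ε} (h : IsFlowMap X A T Ψ) {x : disk k ε} (hx : x ∈ A) {t : ℝ}
    (ht : t ∈ timeInterval T) :
    HasDerivWithinAt (fun s => (Ψ x s : Ambient k)) (X (Ψ x t) t) (Ici t) t :=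
  ((h.hasDeriv x hx t ht).mono inter_subset_right).mono_of_mem_nhdsWithin
    (Filter.inter_mem self_mem_nhdsWithin (timeInterval_mem_nhdsGE ht))

theorem wasserstein_le_exp_mul_cost (hε : 0 < ε) (hε' : ε < Real.pi / 2)
    (hg : IsAdmissibleProfile g) {ρ σ : ℝ → ProbabilityMeasure (disk k ε)}
    (hρ : IsWeakSolution g T ρ) (hσ : IsWeakSolution g T σ)
    {π : ProbabilityMeasure (disk k ε × disk k ε)} (hπ : π ∈ transportPlans (ρ 0) (σ 0))
    {t : ℝ} (ht : t ∈ timeInterval T) :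
    wasserstein (ρ t) (σ t) ≤ Real.exp ((forceLip g ε + forceLip g ε) * t) *
      ∫ p, sphereDist (p.1 : Ambient k) (p.2 : Ambient k)
        ∂(π : Measure (disk k ε × disk k ε)) := by
  obtain ⟨Ψ, hΨ, -, hΨm⟩ := hρ
  obtain ⟨Φ, hΦ, -, hΦm⟩ := hσ
  set P : Measure (disk k ε × disk k ε) := (π : Measure (disk k ε × disk k ε)) with hP
  have hsub : ∀ s ∈ Icc 0 t, s ∈ timeInterval T := fun s hs =>
    ⟨hs.1, (EReal.coe_le_coe_iff.2 hs.2).trans_lt ht.2⟩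
  have h1 : ∀ s ∈ Icc 0 t, AEMeasurable (fun x => Ψ x s) (P.map Prod.fst) := fun s hs => by
    rw [hπ.1]
    exact aemeasurable_of_map_eq (hΨm s (hsub s hs))
  have h2 : ∀ s ∈ Icc 0 t, AEMeasurable (fun x => Φ x s) (P.map Prod.snd) := fun s hs => by
    rw [hπ.2]
    exact aemeasurable_of_map_eq (hΦm s (hsub s hs))
  have hZ : ∀ s ∈ Icc 0 t, AEMeasurable (fun p : disk k ε × disk k ε => Ψ p.1 s) P :=
    fun s hs => (h1 s hs).comp_measurable measurable_fst
  have hW : ∀ s ∈ Icc 0 t, AEMeasurable (fun p : disk k ε × disk k ε => Φ p.2 s) P :=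
    fun s hs => (h2 s hs).comp_measurable measurable_snd
  have hZm : ∀ s ∈ Icc 0 t, (ρ s : Measure (disk k ε)) = P.map fun p => Ψ p.1 s := fun s hs => by
    rw [hΨm s (hsub s hs), ← hπ.1]
    exact AEMeasurable.map_map_of_aemeasurable (h1 s hs) measurable_fst.aemeasurable
  have hWm : ∀ s ∈ Icc 0 t, (σ s : Measure (disk k ε)) = P.map fun p => Φ p.2 s := fun s hs => by
    rw [hΦm s (hsub s hs), ← hπ.2]
    exact AEMeasurable.map_map_of_aemeasurable (h2 s hs) measurable_snd.aemeasurable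
  -- The flows are controlled only on the supports; the marginals are carried by them, so almost
  -- every pair is covered.
  have hsupp : ∀ᵐ p ∂P, p.1 ∈ (ρ 0 : Measure (disk k ε)).support ∧
      p.2 ∈ (σ 0 : Measure (disk k ε)).support := by
    have h3 : ∀ᵐ x ∂(P.map Prod.fst), x ∈ (ρ 0 : Measure (disk k ε)).support := by
      rw [hπ.1]
      exact Measure.support_mem_ae
    have h4 : ∀ᵐ x ∂(P.map Prod.snd), x ∈ (σ 0 : Measure (disk k ε)).support := by
      rw [hπ.2]
      exact Measure.support_mem_ae
    exact (ae_of_ae_map measurable_fst.aemeasurable h3).and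
      (ae_of_ae_map measurable_snd.aemeasurable h4)
  have htt : t ∈ Icc 0 t := ⟨ht.1, le_rfl⟩
  have hG := integral_le_exp_mul_of_deriv_le (P := P) (τ := t) (a := forceLip g ε)
    (b := forceLip g ε) (M := Real.pi)
    (D := fun s p => sphereDist (Ψ p.1 s : Ambient k) (Φ p.2 s)) ht.1 (forceLip_nonneg hε hε')
    (fun s p => sphereDist_nonneg _ _) (fun s p => sphereDist_le_pi _ _)
    (fun s hs => (integrable_sphereDist (hZ s hs) (hW s hs)).aestronglyMeasurable) ?_ ?_ ?_ t htt
  · refine (wasserstein_le_of_maps (hZ t htt) (hW t htt) (hZm t htt) (hWm t htt)).trans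
      (hG.trans_eq ?_)
    congr 1
    refine integral_congr_ae ?_
    filter_upwards [hsupp] with p hp
    rw [hΨ.initial _ hp.1, hΦ.initial _ hp.2]
  · filter_upwards [hsupp] with p hp
    have hc1 : ContinuousOn (fun s => (Ψ p.1 s : Ambient k)) (Icc 0 t) := fun s hs =>
      (hΨ.hasDeriv _ hp.1 s (hsub s hs)).continuousWithinAt.mono hsub
    have hc2 : ContinuousOn (fun s => (Φ p.2 s : Ambient k)) (Icc 0 t) := fun s hs =>
      (hΦ.hasDeriv _ hp.2 s (hsub s hs)).continuousWithinAt.mono hsub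
    exact Real.continuous_arccos.comp_continuousOn (hc1.inner hc2)
  · filter_upwards [hsupp] with p hp s hs h
    have hs' := hsub s (Ico_subset_Icc_self hs)
    exact exists_eventually_slope_sphereDist_lt (hΨ.hasDerivWithinAt_Ici hp.1 hs')
      (hΦ.hasDerivWithinAt_Ici hp.2 hs') h
  · filter_upwards [hsupp] with p hp s hs h
    have hs1 := Ico_subset_Icc_self hs
    have hs' := hsub s hs1
    have hpos := (sphereDist_nonneg (Ψ p.1 s : Ambient k) (Φ p.2 s)).lt_of_ne' h
    refine ⟨_, hasDerivWithinAt_sphereDist hε (hΨ.hasDerivWithinAt_Ici hp.1 hs')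
      (hΦ.hasDerivWithinAt_Ici hp.2 hs') hpos, ?_⟩
    have hsin := Real.sin_pos_of_pos_of_lt_pi hpos
      (by linarith [sphereDist_disk_le (Ψ p.1 s) (Φ p.2 s)])
    rw [velocity_eq_integral_of_map_eq hε hε' hg (hZ s hs1) (hZm s hs1),
      velocity_eq_integral_of_map_eq hε hε' hg (hW s hs1) (hWm s hs1), div_le_iff₀' hsin]
    exact (neg_le_abs _).trans (abs_inner_integral_pairForce_add_le hε hε' hg _ _ (hZ s hs1)
      (hW s hs1))

theorem wasserstein_le_exp_mul_wasserstein (hε : 0 < ε) (hε' : ε < Real.pi / 2)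
    (hg : IsAdmissibleProfile g) {ρ σ : ℝ → ProbabilityMeasure (disk k ε)}
    (hρ : IsWeakSolution g T ρ) (hσ : IsWeakSolution g T σ) {t : ℝ} (ht : t ∈ timeInterval T) :
    wasserstein (ρ t) (σ t) ≤ Real.exp ((forceLip g ε + forceLip g ε) * t) *
      wasserstein (ρ 0) (σ 0) := by
  rw [← div_le_iff₀' (Real.exp_pos _)]
  refine le_csInf ((transportPlans_nonempty _ _).image _) ?_
  rintro _ ⟨π, hπ, rfl⟩
  rw [div_le_iff₀' (Real.exp_pos _)]
  exact wasserstein_le_exp_mul_cost hε hε' hg hρ hσ hπ ht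

theorem two_mul_forceLip_le (hε : 0 < ε) (hε' : ε < Real.pi / 2) :
    forceLip g ε + forceLip g ε ≤ 2 * lipConst g ε + 4 * Real.pi * profileDerivSup g ε := by
  have h1 : 0 ≤ profileDerivSup g ε := profileDerivSup_nonneg
  have h2 := ratioSup_nonneg hε hε'
  have h3 := ratioDerivSup_nonneg hε hε'
  have h4 := Real.pi_pos
  have h5 : 0 ≤ 4 * profileDerivSup g ε * (ratioSup ε + ratioDerivSup ε) := by positivity
  have h6 : 0 ≤ 4 * Real.pi * profileDerivSup g ε := by positivity
  rw [forceLip, lipConst]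
  linarith

end Transport

end SphereAggregation

theorem mainTheorem4 (k : ℕ) (ε : ℝ) (hε : 0 < ε) (hε' : ε < Real.pi / 2)
    (g : ℝ → ℝ) (hg : IsAdmissibleProfile g)
    (T : EReal) (hT : 0 < T)
    (ρ₀ σ₀ : ProbabilityMeasure (disk k ε))
    (ρ σ : ℝ → ProbabilityMeasure (disk k ε))
    (hρ : IsWeakSolution g T ρ) (hρ₀ : ρ 0 = ρ₀)
    (hσ : IsWeakSolution g T σ) (hσ₀ : σ 0 = σ₀) :
    ∃ Tstar : ℝ, 0 < Tstar ∧ (Tstar : EReal) < T ∧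
      stabilityFactor g ε 0 = 1 ∧
      MonotoneOn (stabilityFactor g ε) (Set.Ico 0 Tstar) ∧
      BddAbove (stabilityFactor g ε '' Set.Ico 0 Tstar) ∧
      ∀ t ∈ Set.Ico 0 Tstar,
        wasserstein (ρ t) (σ t) ≤ stabilityFactor g ε t * wasserstein ρ₀ σ₀ := by
  subst hρ₀ hσ₀
  -- Any real number strictly between `0` and `T` can serve as `T*`.
  obtain ⟨τ, h1, h2⟩ := EReal.lt_iff_exists_real_btwn.1 hT
  have hle := two_mul_forceLip_le (g := g) hε hε'
  have hmono : Monotone (stabilityFactor g ε) := fun s t hst =>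
    Real.exp_le_exp.2 (mul_le_mul_of_nonneg_left hst
      ((add_nonneg (forceLip_nonneg hε hε') (forceLip_nonneg hε hε')).trans hle))
  refine ⟨τ, EReal.coe_pos.1 h1, h2, by simp [stabilityFactor], hmono.monotoneOn _,
    ⟨stabilityFactor g ε τ, ?_⟩, fun t ht => ?_⟩
  · rintro _ ⟨t, ht, rfl⟩
    exact hmono ht.2.le
  · refine (wasserstein_le_exp_mul_wasserstein hε hε' hg hρ hσ
      ⟨ht.1, (EReal.coe_lt_coe_iff.2 ht.2).trans h2⟩).trans
      (mul_le_mul_of_nonneg_right ?_ (wasserstein_nonneg _ _))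
    exact Real.exp_le_exp.2 (mul_le_mul_of_nonneg_right hle ht.1)
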